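/- Let $\mathcal M$ be a type $\mathrm{II}_1$ factor, i.e. a von Neumann algebra on a Hilbert space with trivial centre and without minimal projections that admits a faithful normal tracial state, and let $\mathrm{tr}$ be its normalized (faithful normal) trace. Write $\|x\|_2=\mathrm{tr}(x^*x)^{1/2}$ for $x\in\mathcal M$, and for a linear map $\phi:\mathcal M\to\mathcal M$ write $$\|\phi\|_{\infty,2}=\sup\{\|\phi(x)\|_2 : x\in\mathcal M,\ \|x\|\le 1\}.$$ Let $\mathcal A$ be a masa in $\mathcal M$, i.e. a maximal abelian self-adjoint subalgebra of $\mathcal M$. For $\mathcal N=\mathcal A$ or $\mathcal N=u\mathcal Au^*$ with $u\in\mathcal M$ unitary, let $\mathbb E_{\mathcal N}:\mathcal M\to\mathcal N$ denote the unique trace-preserving conditional expectation. Let $\alpha(\mathcal A)$ be the supremum of all real numbers $\alpha$ such that $$\|\mathbb E_{u\mathcal Au^*}-\mathbb E_{\mathcal A}\|_{\infty,2}\ \ge\ \alpha\,\|u-\mathbb E_{\mathcal A}(u)\|_2\qquad\text{for all unitaries } u\in\mathcal M.$$ Then $\alpha(\mathcal A)\le 1$. -/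

import Mathlib

open scoped ComplexOrder

noncomputable section

namespace VNA

variable {H : Type*} [NormedAddCommGroup H] [InnerProductSpace ℂ H] [CompleteSpace H]

/-- The elements of a von Neumann algebra `M` on `H`, as a type; it carries the `*`-algebra
structure and the operator norm inherited from `H →L[ℂ] H`. -/
abbrev Elt (M : VonNeumannAlgebra H) : Type _ := M.toStarSubalgebra

/-- `τ` is a normalized trace on `M`: a faithful normal tracial state. Normality is ultraweak
continuity, i.e. `τ x = ∑ n, ⟪ξ n, x (η n)⟫` for some square-summable sequences of vectors. -/
structure IsNormalizedTrace (M : VonNeumannAlgebra H) (τ : Elt M →ₗ[ℂ] ℂ) : Prop where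
  map_one : τ 1 = 1
  nonneg : ∀ x : Elt M, 0 ≤ τ (star x * x)
  faithful : ∀ x : Elt M, τ (star x * x) = 0 → x = 0
  tracial : ∀ x y : Elt M, τ (x * y) = τ (y * x)
  normal : ∃ ξ η : ℕ → H, Summable (fun n => ‖ξ n‖ ^ 2) ∧ Summable (fun n => ‖η n‖ ^ 2) ∧
    ∀ x : Elt M, HasSum (fun n => inner ℂ (ξ n) ((x : H →L[ℂ] H) (η n))) (τ x)

/-- A type II₁ factor: a von Neumann algebra with trivial centre and without minimal projections
(every nonzero projection has a proper nonzero subprojection) that admits a faithful normal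
tracial state. -/
structure IsTypeIIOneFactor (M : VonNeumannAlgebra H) : Prop where
  factor : ∀ z : Elt M, (∀ x : Elt M, z * x = x * z) → ∃ c : ℂ, z = c • (1 : Elt M)
  no_minimal_projection : ∀ p : Elt M, IsStarProjection p → p ≠ 0 →
    ∃ q : Elt M, IsStarProjection q ∧ p * q = q ∧ q ≠ 0 ∧ q ≠ p
  exists_trace : ∃ τ : Elt M →ₗ[ℂ] ℂ, IsNormalizedTrace M τ

/-- A masa of `M`: a maximal element among the abelian self-adjoint subalgebras of `M`. -/
def IsMasa {M : VonNeumannAlgebra H} (A : StarSubalgebra ℂ (Elt M)) : Prop :=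
  Maximal (fun B : StarSubalgebra ℂ (Elt M) => ∀ x ∈ B, ∀ y ∈ B, x * y = y * x) A

/-- The norm `‖x‖₂ = τ(x* x)^{1/2}`. -/
def norm₂ {M : VonNeumannAlgebra H} (τ : Elt M →ₗ[ℂ] ℂ) (x : Elt M) : ℝ :=
  Real.sqrt (τ (star x * x)).re

/-- The norm `‖φ‖_{∞,2}` of a linear map `φ : M → M`, from the operator norm to `‖·‖₂`
(equal to `⊤` when `φ` is not bounded). -/
def normInftyTwo {M : VonNeumannAlgebra H} (τ : Elt M →ₗ[ℂ] ℂ) (φ : Elt M →ₗ[ℂ] Elt M) : EReal :=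
  ⨆ (x : Elt M) (_ : ‖x‖ ≤ 1), ((norm₂ τ (φ x) : ℝ) : EReal)

/-- `E` is the `τ`-preserving conditional expectation of `M` onto the subalgebra `N`: a positive
`N`-bimodule projection of `M` onto `N` with `τ ∘ E = τ`. -/
structure IsCondExp {M : VonNeumannAlgebra H} (τ : Elt M →ₗ[ℂ] ℂ) (N : StarSubalgebra ℂ (Elt M))
    (E : Elt M →ₗ[ℂ] Elt M) : Prop where
  mem : ∀ x, E x ∈ N
  map_of_mem : ∀ x ∈ N, E x = x
  bimodule : ∀ a ∈ N, ∀ b ∈ N, ∀ x, E (a * x * b) = a * E x * b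
  positive : ∀ x : Elt M, (x : H →L[ℂ] H).IsPositive → (E x : H →L[ℂ] H).IsPositive
  trace_preserving : ∀ x, τ (E x) = τ x

/-- There is at most one trace-preserving conditional expectation onto `N`. -/
theorem IsCondExp.unique {M : VonNeumannAlgebra H} {τ : Elt M →ₗ[ℂ] ℂ}
    (hτ : IsNormalizedTrace M τ) {N : StarSubalgebra ℂ (Elt M)} {E F : Elt M →ₗ[ℂ] Elt M}
    (hE : IsCondExp τ N E) (hF : IsCondExp τ N F) : E = F := by
  ext1 x
  rw [← sub_eq_zero]
  apply hτ.faithful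
  have hd : star (E x - F x) ∈ N := star_mem (sub_mem (hE.mem x) (hF.mem x))
  have h1 := hE.bimodule _ hd 1 (one_mem N) x
  have h2 := hF.bimodule _ hd 1 (one_mem N) x
  simp only [mul_one] at h1 h2
  rw [mul_sub, map_sub, ← h1, ← h2, hE.trace_preserving, hF.trace_preserving, sub_self]

/-- The subalgebra `u N u*`, for a unitary `u` of `M`. -/
def conj {M : VonNeumannAlgebra H} (u : unitary (Elt M)) (N : StarSubalgebra ℂ (Elt M)) :
    StarSubalgebra ℂ (Elt M) :=
  N.map (Unitary.conjStarAlgAut ℂ (Elt M) u : Elt M →⋆ₐ[ℂ] Elt M)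

/-- Membership in `u N u*`, spelled out. -/
theorem mem_conj {M : VonNeumannAlgebra H} (u : unitary (Elt M)) (N : StarSubalgebra ℂ (Elt M))
    (x : Elt M) : x ∈ conj u N ↔ ∃ a ∈ N, (u : Elt M) * a * star (u : Elt M) = x := by
  simp [conj, StarSubalgebra.mem_map, Unitary.conjStarAlgAut_apply]

/-- `N` is `α`-strongly singular: `‖E_{uNu*} - E_N‖_{∞,2} ≥ α ‖u - E_N(u)‖₂` for all unitaries
`u` of `M`. Here `E` and `F` are the conditional expectations onto `N` and onto `uNu*`; they
are unique by `IsCondExp.unique`. -/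
def IsStronglySingular {M : VonNeumannAlgebra H} (τ : Elt M →ₗ[ℂ] ℂ)
    (N : StarSubalgebra ℂ (Elt M)) (α : ℝ) : Prop :=
  ∀ u : unitary (Elt M), ∀ E F : Elt M →ₗ[ℂ] Elt M,
    IsCondExp τ N E → IsCondExp τ (conj u N) F →
      ((α * norm₂ τ ((u : Elt M) - E (u : Elt M)) : ℝ) : EReal) ≤ normInftyTwo τ (F - E)

/-- The invariant `α(N)`: the supremum, in the extended reals, of all real numbers `α` for which
`N` is `α`-strongly singular. -/
def alphaInv {M : VonNeumannAlgebra H} (τ : Elt M →ₗ[ℂ] ℂ) (N : StarSubalgebra ℂ (Elt M)) :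
    EReal :=
  ⨆ (α : ℝ) (_ : IsStronglySingular τ N α), (α : EReal)

end VNA

end

/-! In the inner product `τ(x* y)` a trace-preserving conditional expectation is an orthogonal
projection, and a difference of two orthogonal projections is a contraction. As `‖x‖₂ ≤ ‖x‖`, this
bounds `‖E_{uAu*} - E_A‖_{∞,2}` by 1 (`normInftyTwo_condExp_sub_le_one`). Since `‖u - E_A(u)‖₂² = 1
- ‖E_A(u)‖₂²`, it remains to find unitaries with `‖E_A(u)‖₂` arbitrarily small
(`IsMasa.exists_unitary_norm_condExp_le`).

For this, write `1 = ∑ fᵢ` with orthogonal projections `fᵢ` of `A` of small trace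
(`IsMasa.isSmallSum_one`); they exist because `A` inherits from `M` the absence of minimal
projections. As `A` is abelian, `u` and `w = ∑ fᵢ u fᵢ` have the same expectation, so `‖E_A(u)‖₂² ≤
‖w‖₂² = ∑ τ(fᵢ u fᵢ u*)`. The last sum is linear in the conjugation `Ad u`. In a factor, some convex
combination of conjugations brings every `fᵢ` close to `τ(fᵢ) 1`, where the sum is nearly `∑
τ(fᵢ)²`, which is small; hence it is small at some single `u`.

The averaging takes the element of least `‖·‖₂` in the closed convex hull of a unitary orbit
(`exists_fixed_limit_averages`). Normality of the trace makes operator norm balls `‖·‖₂`-complete,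
so this element lies in `M`. Averaging over the unitaries of `A` also constructs `E_A`, without
which the inequality defining strong singularity could not be applied. -/

open scoped ComplexOrder
noncomputable section
namespace VNA
variable {H : Type*} [NormedAddCommGroup H] [InnerProductSpace ℂ H] [CompleteSpace H]

open Filter Topology

/-! ### C⋆-algebra preliminaries -/

section CStar

variable {B : Type*} [CStarAlgebra B]

/-- The decomposition of a self-adjoint element into orthogonal positive parts, written as
squares. -/
lemma exists_sq_sub_sq {h : B} (hh : IsSelfAdjoint h) :
    ∃ s t : B, IsSelfAdjoint s ∧ IsSelfAdjoint t ∧ s * t = 0 ∧ h = s * s - t * t ∧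
      ∀ b, Commute h b → Commute s b ∧ Commute t b := by
  -- `Real.sqrt` vanishes on negative numbers, so these are the square roots of the positive and
  -- negative parts of `h`.
  refine ⟨cfc (fun x : ℝ => √x) h, cfc (fun x : ℝ => √(-x)) h, cfc_predicate _ _,
    cfc_predicate _ _, ?_, ?_, fun b hb => ⟨hb.cfc_real _, hb.cfc_real _⟩⟩
  · rw [← cfc_mul _ _ _ (by fun_prop) (by fun_prop)]
    have : (fun x : ℝ => √x * √(-x)) = fun _ => 0 := by
      funext x
      rcases le_total x 0 with hx | hx
      · simp [Real.sqrt_eq_zero_of_nonpos hx]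
      · simp [Real.sqrt_eq_zero_of_nonpos (neg_nonpos.2 hx)]
    rw [this, cfc_const_zero]
  · rw [← cfc_mul _ _ _ (by fun_prop) (by fun_prop), ← cfc_mul _ _ _ (by fun_prop) (by fun_prop),
      ← cfc_sub _ _ _ (by fun_prop) (by fun_prop)]
    have : (fun x : ℝ => √x * √x - √(-x) * √(-x)) = fun x => x := by
      funext x
      rcases le_total x 0 with hx | hx
      · simp [Real.sqrt_eq_zero_of_nonpos hx, Real.mul_self_sqrt (neg_nonneg.2 hx)]
      · simp [Real.sqrt_eq_zero_of_nonpos (neg_nonpos.2 hx), Real.mul_self_sqrt hx]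
    rw [this, cfc_id' ℝ h]

lemma exists_one_sub_star_mul_self {x : B} (hx : ‖x‖ ≤ 1) :
    ∃ b : B, 1 - star x * x = star b * b := by
  nontriviality B
  have hsa : IsSelfAdjoint (star x * x) := IsSelfAdjoint.star_mul_self x
  have hb : IsSelfAdjoint (cfc (fun r : ℝ => √(1 - r)) (star x * x)) := cfc_predicate _ _
  refine ⟨cfc (fun r : ℝ => √(1 - r)) (star x * x), ?_⟩
  rw [hb.star_eq, ← cfc_mul _ _ _ (by fun_prop) (by fun_prop)]
  have : Set.EqOn (fun r : ℝ => √(1 - r) * √(1 - r)) (fun r => 1 - r)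
      (spectrum ℝ (star x * x)) := by
    intro r hr
    refine Real.mul_self_sqrt ?_
    have h1 : ‖r‖ ≤ ‖star x * x‖ := spectrum.norm_le_norm_of_mem hr
    rw [CStarRing.norm_star_mul_self] at h1
    have h2 := (Real.le_norm_self r).trans h1
    nlinarith [norm_nonneg x]
  rw [cfc_congr this, cfc_sub _ _ _ (by fun_prop) (by fun_prop), cfc_id' ℝ (star x * x),
    cfc_const_one ℝ (star x * x)]

/-- An element commuting with all unitaries of a C⋆-algebra is central. -/
lemma mul_comm_of_unitary {D : Type*} [Ring D] [Algebra ℂ D] (f : B →ₐ[ℂ] D) {z : D}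
    (hz : ∀ u : unitary B, z * f u = f u * z) (x : B) : z * f x = f x * z := by
  let := CStarAlgebra.spectralOrder B
  let := CStarAlgebra.spectralOrderedRing B
  obtain ⟨u, c, rfl, -⟩ := CStarAlgebra.exists_sum_four_unitary x
  simp [Finset.mul_sum, Finset.sum_mul, hz]

end CStar

/-- As a local instance, closedness makes `Elt M` a C⋆-algebra, so that functional calculus stays
inside `M`. -/
theorem isClosed_elt (M : VonNeumannAlgebra H) :
    IsClosed (M.toStarSubalgebra : Set (H →L[ℂ] H)) := by
  rw [VonNeumannAlgebra.coe_toStarSubalgebra, ← M.centralizer_centralizer]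
  exact Set.isClosed_centralizer _

attribute [local instance] isClosed_elt

/-! ### The pre-Hilbert space of the trace -/

section Trace

variable {M : VonNeumannAlgebra H} {τ : Elt M →ₗ[ℂ] ℂ}

lemma IsNormalizedTrace.map_star (hτ : IsNormalizedTrace M τ) (x : Elt M) :
    τ (star x) = star (τ x) := by
  -- Polarization: the cross terms of `τ((x + c)* (x + c))` are real; `c = 1` and `c = I` then give
  -- both parts.
  have key : ∀ c : ℂ, (star c * τ x + c * τ (star x)).im = 0 := by
    intro c
    have h1 := (Complex.nonneg_iff.1 (hτ.nonneg (x + c • 1))).2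
    have h2 := (Complex.nonneg_iff.1 (hτ.nonneg x)).2
    have h3 := (Complex.nonneg_iff.1 (hτ.nonneg (c • 1))).2
    have e : star (x + c • (1 : Elt M)) * (x + c • 1) =
        star x * x + star (c • (1 : Elt M)) * (c • 1) + star c • x + c • star x := by
      simp only [star_add, star_smul, star_one, add_mul, mul_add, smul_mul_assoc, one_mul,
        mul_smul_comm, mul_one, smul_add]
      abel
    rw [e] at h1
    simp only [map_add, map_smul, Complex.add_im, smul_eq_mul] at h1 h2 h3 ⊢
    linarith
  have h1 := key 1
  have h2 := key Complex.I
  apply Complex.ext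
  · simp at h1 h2 ⊢
    linarith
  · simp at h1 h2 ⊢
    linarith

/-- `M` with the inner product `⟪x, y⟫ = τ(x* y)`. -/
def PreL2 (_ : IsNormalizedTrace M τ) : Type _ := Elt M

variable (hτ : IsNormalizedTrace M τ)

instance : AddCommGroup (PreL2 hτ) := inferInstanceAs (AddCommGroup (Elt M))
instance : Module ℂ (PreL2 hτ) := inferInstanceAs (Module ℂ (Elt M))

/-- The identity map from `M` to its pre-Hilbert space. -/
def toL2 : Elt M ≃ₗ[ℂ] PreL2 hτ := LinearEquiv.refl ℂ (Elt M)

/-- The inner product defined by a trace. -/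
abbrev innerCore : InnerProductSpace.Core ℂ (PreL2 hτ) where
  inner x y := τ (star ((toL2 hτ).symm x) * (toL2 hτ).symm y)
  conj_inner_symm x y := by
    have h := hτ.map_star (star ((toL2 hτ).symm y) * (toL2 hτ).symm x)
    rw [star_mul, star_star] at h
    exact h.symm
  re_inner_nonneg x := (Complex.nonneg_iff.1 (hτ.nonneg _)).1
  add_left x y z := by simp [add_mul]
  smul_left x y r := by simp
  definite x hx := by simpa using hτ.faithful _ hx

instance : NormedAddCommGroup (PreL2 hτ) := (innerCore hτ).toNormedAddCommGroup
instance : InnerProductSpace ℂ (PreL2 hτ) := InnerProductSpace.ofCore (innerCore hτ).toCore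

lemma inner_toL2 (x y : Elt M) : inner ℂ (toL2 hτ x) (toL2 hτ y) = τ (star x * y) := rfl

lemma norm_toL2 (x : Elt M) : ‖toL2 hτ x‖ = norm₂ τ x := by
  rw [norm_eq_sqrt_re_inner (𝕜 := ℂ), inner_toL2]
  rfl

lemma norm_toL2_sq (x : Elt M) : ‖toL2 hτ x‖ ^ 2 = (τ (star x * x)).re := by
  rw [norm_toL2, norm₂, Real.sq_sqrt (Complex.nonneg_iff.1 (hτ.nonneg _)).1]

/-- For a contraction `a`, writing `1 - a* a = b* b` gives `x* x - (ax)* (ax) = (bx)* (bx)`, whose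
trace is nonnegative. -/
lemma norm_toL2_mul_le (a x : Elt M) : ‖toL2 hτ (a * x)‖ ≤ ‖a‖ * ‖toL2 hτ x‖ := by
  have key : ∀ a : Elt M, ‖a‖ ≤ 1 → ‖toL2 hτ (a * x)‖ ≤ ‖toL2 hτ x‖ := by
    intro a ha
    obtain ⟨b, hb⟩ := exists_one_sub_star_mul_self ha
    have h1 := (Complex.nonneg_iff.1 (hτ.nonneg (b * x))).1
    have e : star (b * x) * (b * x) = star x * x - star (a * x) * (a * x) := by
      calc star (b * x) * (b * x) = star x * (star b * b) * x := by simp only [star_mul, mul_assoc]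
        _ = _ := by
          rw [← hb]
          simp only [star_mul, mul_sub, sub_mul, mul_one, mul_assoc]
    rw [e, map_sub, Complex.sub_re, ← norm_toL2_sq hτ, ← norm_toL2_sq hτ, sub_nonneg] at h1
    exact (sq_le_sq₀ (norm_nonneg _) (norm_nonneg _)).1 h1
  rcases eq_or_ne a 0 with rfl | ha
  · simp
  have ha' : 0 < ‖a‖ := norm_pos_iff.2 ha
  have := key (((‖a‖⁻¹ : ℝ) : ℂ) • a) (by
    rw [norm_smul, Complex.norm_real, norm_inv, norm_norm, inv_mul_cancel₀ ha'.ne'])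
  rwa [smul_mul_assoc, map_smul, norm_smul, Complex.norm_real, norm_inv, norm_norm,
    inv_mul_le_iff₀ ha'] at this

lemma norm_toL2_one : ‖toL2 hτ 1‖ = 1 := by
  rw [← sq_eq_sq₀ (norm_nonneg _) zero_le_one, norm_toL2_sq, star_one, one_mul, hτ.map_one]
  simp

lemma norm_toL2_le (x : Elt M) : ‖toL2 hτ x‖ ≤ ‖x‖ := by
  simpa [norm_toL2_one] using norm_toL2_mul_le hτ x 1

lemma norm_trace_mul_le (x y : Elt M) : ‖τ (x * y)‖ ≤ ‖toL2 hτ (star x)‖ * ‖toL2 hτ y‖ := by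
  have := norm_inner_le_norm (𝕜 := ℂ) (toL2 hτ (star x)) (toL2 hτ y)
  rwa [inner_toL2, star_star] at this

lemma norm_toL2_unitary_mul (u : unitary (Elt M)) (x : Elt M) :
    ‖toL2 hτ ((u : Elt M) * x)‖ = ‖toL2 hτ x‖ := by
  rw [← sq_eq_sq₀ (norm_nonneg _) (norm_nonneg _), norm_toL2_sq, norm_toL2_sq, star_mul,
    mul_assoc, ← mul_assoc _ (u : Elt M) x, Unitary.coe_star_mul_self, one_mul]

lemma norm_toL2_star (x : Elt M) : ‖toL2 hτ (star x)‖ = ‖toL2 hτ x‖ := by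
  rw [← sq_eq_sq₀ (norm_nonneg _) (norm_nonneg _), norm_toL2_sq, norm_toL2_sq, star_star,
    hτ.tracial]

lemma norm_toL2_conj (u : unitary (Elt M)) (x : Elt M) :
    ‖toL2 hτ ((u : Elt M) * x * star (u : Elt M))‖ = ‖toL2 hτ x‖ := by
  rw [← norm_toL2_star, star_mul, star_star, norm_toL2_unitary_mul, norm_toL2_star,
    norm_toL2_unitary_mul]

lemma norm_conj (u : unitary (Elt M)) (x : Elt M) :
    ‖(u : Elt M) * x * star (u : Elt M)‖ = ‖x‖ := by
  rw [← Unitary.coe_star, CStarRing.norm_mul_coe_unitary, CStarRing.norm_coe_unitary_mul]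

end Trace

/-! ### Weak limits and `‖·‖₂`-completeness of operator norm balls -/

section Completeness

variable {M : VonNeumannAlgebra H} {τ : Elt M →ₗ[ℂ] ℂ}

lemma inner_mul_apply (a x : Elt M) (ξ η : H) :
    inner ℂ ξ (((a * x : Elt M) : H →L[ℂ] H) η) =
      inner ℂ (((star a : Elt M) : H →L[ℂ] H) ξ) ((x : H →L[ℂ] H) η) := by
  change inner ℂ ξ ((a : H →L[ℂ] H) ((x : H →L[ℂ] H) η)) = inner ℂ (star (a : H →L[ℂ] H) ξ) _
  rw [ContinuousLinearMap.star_eq_adjoint, ContinuousLinearMap.adjoint_inner_left]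

/-- A bounded family in a von Neumann algebra has a weak operator limit along an ultrafilter. -/
lemma exists_tendsto_inner {ι : Type*} (U : Ultrafilter ι) {y : ι → Elt M} {C : ℝ}
    (hy : ∀ n, ‖y n‖ ≤ C) :
    ∃ z : Elt M, ‖z‖ ≤ C ∧ ∀ ξ η : H, Tendsto (fun n => inner ℂ ξ ((y n : H →L[ℂ] H) η)) U
      (𝓝 (inner ℂ ξ ((z : H →L[ℂ] H) η))) := by
  obtain ⟨n₀⟩ : Nonempty ι := U.nonempty_of_neBot
  have hC : 0 ≤ C := (norm_nonneg _).trans (hy n₀)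
  have hbd : ∀ (ξ η : H) n, ‖inner ℂ ((y n : H →L[ℂ] H) ξ) η‖ ≤ C * ‖ξ‖ * ‖η‖ := fun ξ η n =>
    (norm_inner_le_norm _ _).trans (by
      gcongr
      exact ((y n : H →L[ℂ] H).le_opNorm ξ).trans (by gcongr; exact hy n))
  have hlim : ∀ ξ η : H, ∃ c : ℂ, ‖c‖ ≤ C * ‖ξ‖ * ‖η‖ ∧
      Tendsto (fun n => inner ℂ ((y n : H →L[ℂ] H) ξ) η) U (𝓝 c) := by
    intro ξ η
    have hK := isCompact_closedBall (0 : ℂ) (C * ‖ξ‖ * ‖η‖)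
    obtain ⟨c, hc, hlim⟩ := isCompact_iff_ultrafilter_le_nhds.1 hK
      (U.map fun n => inner ℂ ((y n : H →L[ℂ] H) ξ) η) (by
        rw [le_principal_iff]
        exact Eventually.of_forall (f := (U : Filter ι)) fun n => by
          simpa using hbd ξ η n)
    exact ⟨c, by simpa using hc, hlim⟩
  choose b hb hlim using hlim
  -- The limits of the matrix coefficients form a sesquilinear form bounded by `C`; the operator
  -- representing it lies in the double commutant of `M`.
  let B : H →L⋆[ℂ] H →L[ℂ] ℂ := LinearMap.mkContinuous₂
    (LinearMap.mk₂'ₛₗ (starRingEnd ℂ) (RingHom.id ℂ) b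
      (fun ξ ξ' η => tendsto_nhds_unique (hlim _ _) (by
        simpa [inner_add_left] using (hlim ξ η).add (hlim ξ' η)))
      (fun c ξ η => tendsto_nhds_unique (hlim _ _) (by
        simpa [inner_smul_left, mul_comm] using (hlim ξ η).const_mul (starRingEnd ℂ c)))
      (fun ξ η η' => tendsto_nhds_unique (hlim _ _) (by
        simpa [inner_add_right] using (hlim ξ η).add (hlim ξ η')))
      (fun c ξ η => tendsto_nhds_unique (hlim _ _) (by
        simpa [inner_smul_right] using (hlim ξ η).const_mul c))) C hb
  let T : H →L[ℂ] H := InnerProductSpace.continuousLinearMapOfBilin B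
  have hT : ∀ ξ η, inner ℂ (T ξ) η = b ξ η := InnerProductSpace.continuousLinearMapOfBilin_apply B
  have hlim' : ∀ ξ η : H, Tendsto (fun n => inner ℂ ξ ((y n : H →L[ℂ] H) η)) U
      (𝓝 (inner ℂ ξ (T η))) := by
    intro ξ η
    have := (Complex.continuous_conj.tendsto _).comp (hlim η ξ)
    rw [← hT, inner_conj_symm] at this
    refine this.congr fun n => ?_
    simp
  have hmem : T ∈ M.toStarSubalgebra := by
    rw [VonNeumannAlgebra.mem_carrier, ← M.centralizer_centralizer]
    intro a ha
    rw [Set.mem_centralizer_iff] at ha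
    ext η
    refine ext_inner_left ℂ fun ξ => ?_
    refine tendsto_nhds_unique (f := fun n => inner ℂ ξ ((y n : H →L[ℂ] H) (a η)))
      (l := (U : Filter ι))
      ?_ (hlim' ξ (a η))
    have h1 := hlim' (ContinuousLinearMap.adjoint a ξ) η
    simp only [ContinuousLinearMap.adjoint_inner_left] at h1
    refine h1.congr fun n => ?_
    have h2 := congrArg (fun S : H →L[ℂ] H => S η) (ha (y n : H →L[ℂ] H) (y n).2)
    simp only [mul_apply_eq_comp] at h2
    rw [h2]
  refine ⟨⟨T, hmem⟩, ?_, hlim'⟩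
  refine T.opNorm_le_bound hC fun ξ => ?_
  rcases eq_or_ne (T ξ) 0 with h0 | h0
  · rw [h0, norm_zero]
    positivity
  have h1 := hb ξ (T ξ)
  rw [← hT, inner_self_eq_norm_sq_to_K, norm_pow, RCLike.norm_ofReal, abs_norm, sq] at h1
  exact le_of_mul_le_mul_right h1 (norm_pos_iff.2 h0)

/-- Normality of the trace along bounded weakly convergent families. -/
lemma IsNormalizedTrace.tendsto_mul (hτ : IsNormalizedTrace M τ) {ι : Type*} {l : Filter ι}
    {y : ι → Elt M} {C : ℝ} (hy : ∀ n, ‖y n‖ ≤ C) {z : Elt M}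
    (hz : ∀ ξ η : H, Tendsto (fun n => inner ℂ ξ ((y n : H →L[ℂ] H) η)) l
      (𝓝 (inner ℂ ξ ((z : H →L[ℂ] H) η)))) (a : Elt M) :
    Tendsto (fun n => τ (a * y n)) l (𝓝 (τ (a * z))) := by
  obtain ⟨ξ, η, hξ, hη, hs⟩ := hτ.normal
  simp_rw [← (hs _).tsum_eq]
  refine tendsto_tsum_of_dominated_convergence
    (bound := fun k => (‖a‖ * C) * (‖ξ k‖ ^ 2 + ‖η k‖ ^ 2)) ((hξ.add hη).mul_left _) ?_ ?_
  · intro k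
    simp_rw [inner_mul_apply]
    exact hz _ _
  · refine Eventually.of_forall fun n k => ?_
    have hC : 0 ≤ C := (norm_nonneg _).trans (hy n)
    have h1 : ‖((a * y n : Elt M) : H →L[ℂ] H) (η k)‖ ≤ ‖a‖ * C * ‖η k‖ := by
      refine (((a * y n : Elt M) : H →L[ℂ] H).le_opNorm _).trans ?_
      gcongr
      exact (norm_mul_le a (y n)).trans (by gcongr; exact hy n)
    refine (norm_inner_le_norm _ _).trans ?_
    calc ‖ξ k‖ * ‖((a * y n : Elt M) : H →L[ℂ] H) (η k)‖
        ≤ ‖ξ k‖ * (‖a‖ * C * ‖η k‖) := by gcongr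
      _ = ‖a‖ * C * (‖ξ k‖ * ‖η k‖) := by ring
      _ ≤ _ := by
        gcongr
        nlinarith [sq_nonneg (‖ξ k‖ - ‖η k‖), sq_nonneg ‖ξ k‖, sq_nonneg ‖η k‖]

variable (hτ : IsNormalizedTrace M τ)

/-- A bounded `‖·‖₂`-Cauchy sequence converges to its weak operator limits. -/
lemma exists_tendsto_toL2 {y : ℕ → Elt M} {C : ℝ} (hy : ∀ n, ‖y n‖ ≤ C)
    (hc : CauchySeq fun n => toL2 hτ (y n)) :
    ∃ z : Elt M, ‖z‖ ≤ C ∧ Tendsto (fun n => toL2 hτ (y n)) atTop (𝓝 (toL2 hτ z)) ∧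
      ∀ ξ η : H, Tendsto (fun n => inner ℂ ξ ((y n : H →L[ℂ] H) η)) (hyperfilter ℕ)
        (𝓝 (inner ℂ ξ ((z : H →L[ℂ] H) η))) := by
  obtain ⟨z, hzC, hz⟩ := exists_tendsto_inner (hyperfilter ℕ) hy
  refine ⟨z, hzC, ?_, hz⟩
  rw [Metric.tendsto_atTop]
  intro ε hε
  obtain ⟨N, hN⟩ := Metric.cauchySeq_iff.1 hc (ε / 2) (by positivity)
  refine ⟨N, fun n hn => ?_⟩
  -- By normality, `‖z - yₙ‖₂²` is the limit over `m` of `τ((z - yₙ)* (yₘ - yₙ))`; Cauchy–Schwarz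
  -- bounds it by `‖z - yₙ‖₂ · ε / 2`, and one factor cancels.
  have key : Tendsto (fun m => τ (star (z - y n) * (y m - y n))) (hyperfilter ℕ)
      (𝓝 (τ (star (z - y n) * (z - y n)))) := by
    simp_rw [mul_sub, map_sub]
    exact (hτ.tendsto_mul hy hz _).sub tendsto_const_nhds
  have hle : ‖τ (star (z - y n) * (z - y n))‖ ≤ ‖toL2 hτ (z - y n)‖ * (ε / 2) := by
    refine le_of_tendsto key.norm ?_
    have : ∀ᶠ m in (hyperfilter ℕ : Filter ℕ), N ≤ m :=
      Nat.hyperfilter_le_atTop (eventually_ge_atTop N)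
    filter_upwards [this] with m hm
    refine (norm_trace_mul_le hτ _ _).trans ?_
    rw [star_star]
    gcongr
    rw [map_sub, ← dist_eq_norm]
    exact (hN m hm n hn).le
  have h2 := (Complex.re_le_norm _).trans hle
  rw [← norm_toL2_sq hτ, sq] at h2
  rw [dist_comm, dist_eq_norm, ← map_sub]
  rcases (norm_nonneg (toL2 hτ (z - y n))).eq_or_lt with h0 | h0
  · rw [← h0]; exact hε
  · exact (le_of_mul_le_mul_left h2 h0).trans_lt (by linarith)

lemma isComplete_ball (C : ℝ) : IsComplete (toL2 hτ '' {x : Elt M | ‖x‖ ≤ C}) := by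
  rw [← completeSpace_coe_iff_isComplete]
  refine Metric.complete_of_cauchySeq_tendsto fun u hu => ?_
  choose y hy hyu using fun n => (u n).2
  have hc : CauchySeq fun n => toL2 hτ (y n) := by
    simp_rw [hyu]
    exact hu.map uniformContinuous_subtype_val
  obtain ⟨z, hz, hlim, -⟩ := exists_tendsto_toL2 hτ hy hc
  refine ⟨⟨toL2 hτ z, z, hz, rfl⟩, ?_⟩
  rw [tendsto_subtype_rng]
  simpa only [hyu] using hlim

/-- Positivity passes to `‖·‖₂`-limits of bounded sequences. -/
lemma isPositive_of_tendsto {y : ℕ → Elt M} {C : ℝ} (hy : ∀ n, ‖y n‖ ≤ C)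
    (hp : ∀ n, (y n : H →L[ℂ] H).IsPositive) {z : Elt M}
    (hz : Tendsto (fun n => toL2 hτ (y n)) atTop (𝓝 (toL2 hτ z))) :
    (z : H →L[ℂ] H).IsPositive := by
  obtain ⟨w, -, hw, hlim⟩ := exists_tendsto_toL2 hτ hy hz.cauchySeq
  obtain rfl : z = w := (toL2 hτ).injective (tendsto_nhds_unique hz hw)
  rw [ContinuousLinearMap.isPositive_iff_complex]
  intro ξ
  have h1 : (0 : ℂ) ≤ inner ℂ ξ ((z : H →L[ℂ] H) ξ) :=
    ge_of_tendsto (hlim ξ ξ) (Eventually.of_forall fun n => (hp n).inner_nonneg_right ξ)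
  have h2 : (0 : ℂ) ≤ inner ℂ ((z : H →L[ℂ] H) ξ) ξ := by
    rw [← inner_conj_symm]
    exact star_nonneg_iff.2 h1
  rw [Complex.nonneg_iff] at h2
  exact ⟨Complex.ext (by simp) (by simpa using h2.2), h2.1⟩

end Completeness

/-! ### Convex combinations of unitary conjugations -/

section Averages

variable {M : VonNeumannAlgebra H} {τ : Elt M →ₗ[ℂ] ℂ}

set_option synthInstance.maxHeartbeats 400000 in
local instance moduleRealEnd : Module ℝ (Module.End ℂ (Elt M)) := inferInstance

/-- Conjugation `x ↦ u x u*`. -/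
def ad (u : unitary (Elt M)) : Module.End ℂ (Elt M) :=
  LinearMap.mulLeft ℂ (u : Elt M) * LinearMap.mulRight ℂ (star (u : Elt M))

lemma ad_apply (u : unitary (Elt M)) (x : Elt M) :
    ad u x = (u : Elt M) * x * star (u : Elt M) := by
  simp [ad, mul_assoc]

lemma ad_mul (u v : unitary (Elt M)) : ad (u * v) = ad u * ad v := by
  ext1 x
  simp [ad_apply, mul_assoc]

/-- The averages of conjugations by elements of `S`. -/
def averages (S : Subgroup (unitary (Elt M))) : Set (Module.End ℂ (Elt M)) :=
  convexHull ℝ (ad '' (S : Set (unitary (Elt M))))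

lemma ad_mem_averages {S : Subgroup (unitary (Elt M))} {u : unitary (Elt M)} (hu : u ∈ S) :
    ad u ∈ averages S := subset_convexHull ℝ _ ⟨u, hu, rfl⟩

/-- A property that defines a convex set of maps need only be checked on single conjugations. -/
lemma averages_induction {S : Subgroup (unitary (Elt M))} {P : Set (Module.End ℂ (Elt M))}
    (hP : Convex ℝ P) (h : ∀ u ∈ S, ad u ∈ P) {T : Module.End ℂ (Elt M)} (hT : T ∈ averages S) :
    T ∈ P :=
  convexHull_min (by rintro _ ⟨u, hu, rfl⟩; exact h u hu) hP hT

lemma mul_mem_averages {S : Subgroup (unitary (Elt M))} {T T' : Module.End ℂ (Elt M)}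
    (hT : T ∈ averages S) (hT' : T' ∈ averages S) : T * T' ∈ averages S := by
  refine averages_induction (P := {T | T * T' ∈ averages S})
    ((convex_convexHull ℝ _).linear_preimage (LinearMap.mulRight ℝ T')) (fun u hu => ?_) hT
  refine averages_induction (P := {T' | ad u * T' ∈ averages S})
    ((convex_convexHull ℝ _).linear_preimage (LinearMap.mulLeft ℝ (ad u))) (fun v hv => ?_) hT'
  rw [Set.mem_ofPred_eq, ← ad_mul]
  exact ad_mem_averages (mul_mem hu hv)

lemma norm_average_le {S : Subgroup (unitary (Elt M))} {T : Module.End ℂ (Elt M)}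
    (hT : T ∈ averages S) (x : Elt M) : ‖T x‖ ≤ ‖x‖ := by
  have := averages_induction (P := {T | T x ∈ Metric.closedBall (0 : Elt M) ‖x‖})
    ((convex_closedBall _ _).linear_preimage
      ((LinearMap.applyₗ (R := ℂ) x : Module.End ℂ (Elt M) →ₗ[ℂ] Elt M).restrictScalars ℝ))
    (fun u _ => by
      rw [Set.mem_ofPred_eq, mem_closedBall_zero_iff, ad_apply, norm_conj]) hT
  simpa using this

lemma norm_toL2_average_le (hτ : IsNormalizedTrace M τ) {S : Subgroup (unitary (Elt M))}
    {T : Module.End ℂ (Elt M)} (hT : T ∈ averages S) (x : Elt M) :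
    ‖toL2 hτ (T x)‖ ≤ ‖toL2 hτ x‖ := by
  have := averages_induction (P := {T | toL2 hτ (T x) ∈ Metric.closedBall 0 ‖toL2 hτ x‖})
    ((convex_closedBall _ _).linear_preimage
      (((toL2 hτ).toLinearMap ∘ₗ
        (LinearMap.applyₗ (R := ℂ) x : Module.End ℂ (Elt M) →ₗ[ℂ] Elt M)).restrictScalars ℝ))
    (fun u _ => by simp [ad_apply, norm_toL2_conj]) hT
  simpa using this

/-- An average of `x` by `S` has the same trace as `x` against elements commuting with `S`. -/
lemma trace_mul_average (hτ : IsNormalizedTrace M τ) {S : Subgroup (unitary (Elt M))}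
    {T : Module.End ℂ (Elt M)} (hT : T ∈ averages S) {a : Elt M}
    (ha : ∀ u ∈ S, (u : Elt M) * a = a * u) (x : Elt M) : τ (a * T x) = τ (a * x) := by
  refine averages_induction (P := {T | τ (a * T x) ∈ ({τ (a * x)} : Set ℂ)})
    ((convex_singleton _).linear_preimage
      ((τ ∘ₗ LinearMap.mulLeft ℂ a ∘ₗ
        (LinearMap.applyₗ (R := ℂ) x : Module.End ℂ (Elt M) →ₗ[ℂ] Elt M)).restrictScalars ℝ))
    (fun u hu => ?_) hT
  rw [Set.mem_ofPred_eq, Set.mem_singleton_iff, ad_apply, ← mul_assoc, ← mul_assoc, hτ.tracial,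
    ← ha u hu, ← mul_assoc, ← mul_assoc, Unitary.coe_star_mul_self, one_mul]

lemma isPositive_average {S : Subgroup (unitary (Elt M))}
    {T : Module.End ℂ (Elt M)} (hT : T ∈ averages S) {x : Elt M}
    (hx : (x : H →L[ℂ] H).IsPositive) : (T x : H →L[ℂ] H).IsPositive := by
  refine averages_induction (P := {T | (T x : H →L[ℂ] H).IsPositive}) ?_ (fun u _ => ?_) hT
  · rintro T₁ h₁ T₂ h₂ a b ha hb -
    simp only [Set.mem_ofPred_eq, ← ContinuousLinearMap.nonneg_iff_isPositive] at h₁ h₂ ⊢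
    exact add_nonneg (smul_nonneg (Complex.zero_le_real.2 ha) h₁)
      (smul_nonneg (Complex.zero_le_real.2 hb) h₂)
  · rw [Set.mem_ofPred_eq, ad_apply]
    exact hx.conj_adjoint ((u : Elt M) : H →L[ℂ] H)

/-- Among the `‖·‖₂`-limits of averages of `x` by `S` there is one that is fixed by `S`. -/
lemma exists_fixed_limit_averages (hτ : IsNormalizedTrace M τ) (S : Subgroup (unitary (Elt M)))
    (x : Elt M) : ∃ (y : Elt M) (T : ℕ → Module.End ℂ (Elt M)), (∀ n, T n ∈ averages S) ∧
      Tendsto (fun n => toL2 hτ (T n x)) atTop (𝓝 (toL2 hτ y)) ∧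
      ∀ u ∈ S, (u : Elt M) * y = y * u := by
  let ev : Module.End ℂ (Elt M) →ₗ[ℝ] PreL2 hτ := ((toL2 hτ).toLinearMap ∘ₗ
    (LinearMap.applyₗ (R := ℂ) x : Module.End ℂ (Elt M) →ₗ[ℂ] Elt M)).restrictScalars ℝ
  have hev : ∀ T, ev T = toL2 hτ (T x) := fun T => rfl
  let K : Set (PreL2 hτ) := closure (ev '' averages S)
  have hconv : Convex ℝ K := ((convex_convexHull ℝ _).linear_image ev).closure
  have hball := isComplete_ball hτ ‖x‖
  -- `PreL2` itself need not be complete; `K` is, being a closed part of a complete ball.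
  have hsub : K ⊆ toL2 hτ '' {y : Elt M | ‖y‖ ≤ ‖x‖} := by
    refine closure_minimal ?_ hball.isClosed
    rintro _ ⟨T, hT, rfl⟩
    exact ⟨T x, norm_average_le hT x, rfl⟩
  have hne : K.Nonempty := ⟨ev (ad 1), subset_closure ⟨_, ad_mem_averages S.one_mem, rfl⟩⟩
  have hcomp : IsComplete K := fun F hF hFK => by
    obtain ⟨w, -, hw⟩ := hball F hF (hFK.trans (principal_mono.2 hsub))
    have := hF.1
    exact ⟨w, isClosed_closure.mem_of_tendsto (f := id) hw (le_principal_iff.1 hFK), hw⟩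
  let := InnerProductSpace.rclikeToReal ℂ (PreL2 hτ)
  obtain ⟨v, hvK, hv⟩ := exists_norm_eq_iInf_of_complete_convex hne hcomp hconv 0
  have hmin := (norm_eq_iInf_iff_real_inner_le_zero hconv hvK).1 hv
  obtain ⟨y, -, rfl⟩ := hsub hvK
  obtain ⟨t, ht, hlim⟩ := mem_closure_iff_seq_limit.1 hvK
  choose T hT hTt using ht
  refine ⟨y, T, hT, ?_, fun u hu => ?_⟩
  · simpa only [← hev, hTt] using hlim
  have hcont : Continuous fun w : PreL2 hτ => toL2 hτ (ad u ((toL2 hτ).symm w)) := by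
    refine Isometry.continuous (AddMonoidHomClass.isometry_of_norm
      ((toL2 hτ).toLinearMap ∘ₗ ad u ∘ₗ (toL2 hτ).symm.toLinearMap) fun w => ?_)
    simpa [ad_apply] using norm_toL2_conj hτ u ((toL2 hτ).symm w)
  have hmem : toL2 hτ (ad u y) ∈ K := by
    have : Set.MapsTo (fun w : PreL2 hτ => toL2 hτ (ad u ((toL2 hτ).symm w)))
        (ev '' averages S) (ev '' averages S) := by
      rintro _ ⟨T, hT, rfl⟩
      exact ⟨ad u * T, mul_mem_averages (ad_mem_averages hu) hT, rfl⟩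
    simpa using this.closure hcont hvK
  have h1 := hmin _ hmem
  have h2 : ‖toL2 hτ (ad u y)‖ = ‖toL2 hτ y‖ := by rw [ad_apply, norm_toL2_conj]
  -- `ad u y` lies in `K` and has the minimal norm, so it equals the minimizer `y`.
  have h3 : ad u y = y := by
    refine (toL2 hτ).injective (sub_eq_zero.1 (norm_eq_zero.1 ?_))
    have h4 := norm_sub_sq_real (toL2 hτ (ad u y)) (toL2 hτ y)
    rw [zero_sub, inner_neg_left, inner_sub_right, real_inner_self_eq_norm_sq] at h1
    rw [real_inner_comm] at h4
    rw [h2] at h4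
    nlinarith [norm_nonneg (toL2 hτ (ad u y) - toL2 hτ y)]
  nth_rw 2 [← h3]
  rw [ad_apply, mul_assoc _ (star _), Unitary.coe_star_mul_self, mul_one]

end Averages

/-! ### Conditional expectations onto a masa and its conjugates -/

section CondExp

variable {M : VonNeumannAlgebra H} {τ : Elt M →ₗ[ℂ] ℂ} {A : StarSubalgebra ℂ (Elt M)}

/-- A masa is its own relative commutant. -/
lemma IsMasa.mem_of_commute (hA : IsMasa A) {x : Elt M} (hx : ∀ a ∈ A, a * x = x * a) :
    x ∈ A := by
  have key : ∀ x : Elt M, IsSelfAdjoint x → (∀ a ∈ A, a * x = x * a) → x ∈ A := by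
    intro x hsa hx
    have h1 : ∀ a ∈ insert x (A : Set (Elt M)), ∀ b ∈ insert x (A : Set (Elt M)),
        a * b = b * a := by
      rintro a (rfl | ha) b (rfl | hb)
      · rfl
      · exact (hx b hb).symm
      · exact hx a ha
      · exact hA.prop a ha b hb
    have h2 : ∀ b ∈ insert x (A : Set (Elt M)), star b ∈ insert x (A : Set (Elt M)) := by
      rintro b (rfl | hb)
      · exact Or.inl hsa
      · exact Or.inr (star_mem hb)
    have hcomm := StarAlgebra.isMulCommutative_adjoin ℂ h1 fun a ha b hb => h1 a ha _ (h2 b hb)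
    have hle : A ≤ StarAlgebra.adjoin ℂ (insert x (A : Set (Elt M))) := fun a ha =>
      StarAlgebra.subset_adjoin ℂ _ (Or.inr ha)
    refine hA.le_of_ge ?_ hle (StarAlgebra.subset_adjoin ℂ _ (Or.inl rfl))
    exact fun a ha b hb => congrArg Subtype.val (hcomm.is_comm.comm
      (⟨a, ha⟩ : StarAlgebra.adjoin ℂ (insert x (A : Set (Elt M)))) ⟨b, hb⟩)
  have hx' : ∀ a ∈ A, a * star x = star x * a := fun a ha => by
    simpa using (congrArg star (hx (star a) (star_mem ha))).symm
  have hre : ((realPart x : selfAdjoint (Elt M)) : Elt M) ∈ A := key _ (realPart x).2 fun a ha => by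
    rw [realPart_apply_coe, mul_smul_comm, smul_mul_assoc, mul_add, add_mul, hx a ha, hx' a ha]
  have him : ((imaginaryPart x : selfAdjoint (Elt M)) : Elt M) ∈ A :=
    key _ (imaginaryPart x).2 fun a ha => by
      rw [imaginaryPart_apply_coe, mul_smul_comm, smul_mul_assoc, mul_smul_comm, smul_mul_assoc,
        mul_sub, sub_mul, hx a ha, hx' a ha]
  rw [← realPart_add_I_smul_imaginaryPart x]
  exact add_mem hre (A.smul_mem him _)

/-- A masa equals its relative commutant. Closedness makes it a C⋆-algebra, hence spanned by its
unitaries. -/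
lemma IsMasa.isClosed (hA : IsMasa A) : IsClosed (A : Set (Elt M)) := by
  have : (A : Set (Elt M)) = Set.centralizer A := by
    refine Set.Subset.antisymm (fun x hx => ?_) fun x hx => ?_
    · exact Set.mem_centralizer_iff.2 fun a ha => hA.prop a ha x hx
    · exact hA.mem_of_commute (Set.mem_centralizer_iff.1 hx)
  rw [this]
  exact Set.isClosed_centralizer _

/-- The unitaries of `M` that lie in `A`. -/
def unitarySubgroup (A : StarSubalgebra ℂ (Elt M)) : Subgroup (unitary (Elt M)) where
  carrier := {u | (u : Elt M) ∈ A}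
  mul_mem' ha hb := mul_mem (s := A) ha hb
  one_mem' := one_mem A
  inv_mem' ha := star_mem (s := A) ha

/-- The existence of `E_A x`, determined by its traces against `A`. -/
lemma IsMasa.exists_condExp_apply (hτ : IsNormalizedTrace M τ) (hA : IsMasa A) (x : Elt M) :
    ∃ y ∈ A, (∀ a ∈ A, τ (a * y) = τ (a * x)) ∧
      ((x : H →L[ℂ] H).IsPositive → (y : H →L[ℂ] H).IsPositive) := by
  obtain ⟨y, T, hT, hlim, hy⟩ := exists_fixed_limit_averages hτ (unitarySubgroup A) x
  refine ⟨y, hA.mem_of_commute fun a ha => ?_, fun a ha => ?_, fun hx => ?_⟩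
  · have : IsClosed (A : Set (Elt M)) := hA.isClosed
    have h1 := mul_comm_of_unitary (A.subtype : A →⋆ₐ[ℂ] Elt M).toAlgHom (z := y) (fun u => ?_)
      ⟨a, ha⟩
    · exact h1.symm
    · have hu : ((u : A) : Elt M) ∈ unitary (Elt M) :=
        ⟨congrArg Subtype.val u.2.1, congrArg Subtype.val u.2.2⟩
      exact (hy ⟨_, hu⟩ (u : A).2).symm
  · have h1 : Tendsto (fun n => τ (a * T n x)) atTop (𝓝 (τ (a * y))) := by
      have := (tendsto_const_nhds (x := toL2 hτ (star a))).inner (𝕜 := ℂ) hlim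
      simpa only [inner_toL2, star_star] using this
    refine tendsto_nhds_unique h1 ?_
    simp_rw [trace_mul_average hτ (hT _) (fun u hu => hA.prop _ hu a ha) x]
    exact tendsto_const_nhds
  · exact isPositive_of_tendsto hτ (fun n => norm_average_le (hT n) x)
      (fun n => isPositive_average (hT n) hx) hlim

/-- Test against `a = (y - z)*` and use faithfulness. Linearity and the bimodule property of `E_A`
follow from this uniqueness. -/
lemma eq_of_trace_mul_eq (hτ : IsNormalizedTrace M τ) {y z : Elt M} (hy : y ∈ A) (hz : z ∈ A)
    (h : ∀ a ∈ A, τ (a * y) = τ (a * z)) : y = z := by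
  rw [← sub_eq_zero]
  apply hτ.faithful
  rw [mul_sub, map_sub, h _ (star_mem (sub_mem hy hz)), sub_self]

/-- A masa has a trace-preserving conditional expectation. -/
lemma IsMasa.exists_isCondExp (hτ : IsNormalizedTrace M τ) (hA : IsMasa A) :
    ∃ E : Elt M →ₗ[ℂ] Elt M, IsCondExp τ A E := by
  choose e he hτe hpos using hA.exists_condExp_apply hτ
  refine ⟨{ toFun := e, map_add' := fun x y => ?_, map_smul' := fun c x => ?_ },
    he, fun x hx => ?_, fun a ha b hb x => ?_, hpos, fun x => ?_⟩
  · refine eq_of_trace_mul_eq hτ (he _) (add_mem (he _) (he _)) fun a ha => ?_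
    rw [hτe _ a ha, mul_add, mul_add, map_add, map_add, hτe _ a ha, hτe _ a ha]
  · refine eq_of_trace_mul_eq hτ (he _) (A.smul_mem (he _) _) fun a ha => ?_
    simp only [RingHom.id_apply, mul_smul_comm, map_smul, hτe _ a ha]
  · exact eq_of_trace_mul_eq hτ (he _) hx fun a ha => hτe _ a ha
  · refine eq_of_trace_mul_eq hτ (he _) (mul_mem (mul_mem ha (he x)) hb) fun c hc => ?_
    have h1 : ∀ z, τ (c * (a * z * b)) = τ (b * c * a * z) := fun z => by
      rw [← mul_assoc, hτ.tracial, ← mul_assoc, ← mul_assoc]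
    change τ (c * e (a * x * b)) = τ (c * (a * e x * b))
    rw [hτe _ c hc, h1, h1, hτe _ _ (mul_mem (mul_mem hb hc) ha)]
  · simpa using hτe x 1 (one_mem A)

/-- Provides the expectation `F` onto `uAu*` to which strong singularity is applied. -/
lemma IsCondExp.conj (hτ : IsNormalizedTrace M τ) {E : Elt M →ₗ[ℂ] Elt M} (hE : IsCondExp τ A E)
    (u : unitary (Elt M)) : IsCondExp τ (conj u A) (ad u * E * ad (star u)) := by
  have hF : ∀ x, (ad u * E * ad (star u)) x =
      (u : Elt M) * E (star (u : Elt M) * x * u) * star (u : Elt M) := fun x => by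
    simp [ad_apply]
  have hc : ∀ x : Elt M, star (u : Elt M) * ((u : Elt M) * x) = x := fun x => by
    rw [← mul_assoc, Unitary.coe_star_mul_self, one_mul]
  refine ⟨fun x => ?_, fun x hx => ?_, fun a ha b hb x => ?_, fun x hx => ?_, fun x => ?_⟩
  · rw [hF, mem_conj]
    exact ⟨_, hE.mem _, rfl⟩
  · obtain ⟨a, ha, rfl⟩ := (mem_conj u A x).1 hx
    rw [hF]
    simp only [mul_assoc, hc, Unitary.coe_star_mul_self, mul_one, hE.map_of_mem a ha]
  · obtain ⟨a, ha', rfl⟩ := (mem_conj u A _).1 ha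
    obtain ⟨b, hb', rfl⟩ := (mem_conj u A _).1 hb
    rw [hF, hF]
    have := hE.bimodule a ha' b hb' (star (u : Elt M) * x * u)
    simp only [mul_assoc, hc, Unitary.coe_star_mul_self, mul_one] at this ⊢
    rw [this]
    simp only [mul_assoc]
  · rw [hF]
    refine (hE.positive _ ?_).conj_adjoint ((u : Elt M) : H →L[ℂ] H)
    exact hx.adjoint_conj ((u : Elt M) : H →L[ℂ] H)
  · rw [hF, hτ.tracial, hc, hE.trace_preserving, hτ.tracial, ← mul_assoc,
      Unitary.mul_star_self_of_mem u.2, one_mul]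

/-- Orthogonality of the projection `E`: apply `τ ∘ E = τ` to `E(x)* x` and take `E(x)*` out of `E`.
-/
lemma IsCondExp.inner_apply_self (hτ : IsNormalizedTrace M τ) {E : Elt M →ₗ[ℂ] Elt M}
    (hE : IsCondExp τ A E) (x : Elt M) :
    inner ℂ (toL2 hτ (E x)) (toL2 hτ x) = inner ℂ (toL2 hτ (E x)) (toL2 hτ (E x)) := by
  have := hE.bimodule _ (star_mem (hE.mem x)) 1 (one_mem A) x
  rw [mul_one, mul_one] at this
  rw [inner_toL2, inner_toL2, ← this, hE.trace_preserving]

lemma IsCondExp.norm_sub_apply_sq (hτ : IsNormalizedTrace M τ) {E : Elt M →ₗ[ℂ] Elt M}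
    (hE : IsCondExp τ A E) (x : Elt M) :
    ‖toL2 hτ (x - E x)‖ ^ 2 = ‖toL2 hτ x‖ ^ 2 - ‖toL2 hτ (E x)‖ ^ 2 := by
  have h1 := congrArg Complex.re (hE.inner_apply_self hτ x)
  have h2 := norm_sub_sq (𝕜 := ℂ) (toL2 hτ x) (toL2 hτ (E x))
  have h3 := inner_self_eq_norm_sq (𝕜 := ℂ) (toL2 hτ (E x))
  rw [inner_re_symm] at h2
  simp only [RCLike.re_eq_complex_re] at h2 h3
  rw [map_sub]
  linarith

/-- The difference of two conditional expectations is a contraction for `‖·‖₂`. -/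
lemma norm_condExp_sub_le (hτ : IsNormalizedTrace M τ) {B : StarSubalgebra ℂ (Elt M)}
    {E F : Elt M →ₗ[ℂ] Elt M} (hE : IsCondExp τ A E) (hF : IsCondExp τ B F) (x : Elt M) :
    ‖toL2 hτ (F x - E x)‖ ≤ ‖toL2 hτ x‖ := by
  have hE' := congrArg Complex.re (hE.inner_apply_self hτ x)
  have hF' := congrArg Complex.re (hF.inner_apply_self hτ x)
  have h1 := norm_sub_sq (𝕜 := ℂ) (toL2 hτ (F x)) (toL2 hτ (E x))
  have h2 := norm_sub_sq (𝕜 := ℂ) (toL2 hτ x) (toL2 hτ (F x) + toL2 hτ (E x))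
  have h3 := norm_add_sq (𝕜 := ℂ) (toL2 hτ (F x)) (toL2 hτ (E x))
  have h4 := inner_self_eq_norm_sq (𝕜 := ℂ) (toL2 hτ (E x))
  have h5 := inner_self_eq_norm_sq (𝕜 := ℂ) (toL2 hτ (F x))
  rw [inner_re_symm, inner_add_left] at h2
  simp only [RCLike.re_eq_complex_re, Complex.add_re] at h1 h2 h3 h4 h5
  rw [map_sub, ← sq_le_sq₀ (norm_nonneg _) (norm_nonneg _)]
  -- In fact `‖x‖₂² - ‖Fx - Ex‖₂² = ‖x - Fx - Ex‖₂²`.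
  nlinarith [sq_nonneg ‖toL2 hτ x - (toL2 hτ (F x) + toL2 hτ (E x))‖]

lemma normInftyTwo_condExp_sub_le_one (hτ : IsNormalizedTrace M τ) {B : StarSubalgebra ℂ (Elt M)}
    {E F : Elt M →ₗ[ℂ] Elt M} (hE : IsCondExp τ A E) (hF : IsCondExp τ B F) :
    normInftyTwo τ (F - E) ≤ 1 := by
  refine iSup₂_le fun x hx => ?_
  rw [← norm_toL2 hτ, ← EReal.coe_one, EReal.coe_le_coe_iff]
  exact (norm_condExp_sub_le hτ hE hF x).trans ((norm_toL2_le hτ x).trans hx)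

end CondExp

/-! ### Averaging to scalars, and diffuseness of masas -/

section Projections

variable {M : VonNeumannAlgebra H} {τ : Elt M →ₗ[ℂ] ℂ} {A : StarSubalgebra ℂ (Elt M)}

/-! ### Averaging in a factor -/

lemma average_one {S : Subgroup (unitary (Elt M))} {T : Module.End ℂ (Elt M)}
    (hT : T ∈ averages S) : T 1 = 1 := by
  refine averages_induction (P := {T | T 1 ∈ ({1} : Set (Elt M))})
    ((convex_singleton _).linear_preimage
      ((LinearMap.applyₗ (R := ℂ) (1 : Elt M) :
        Module.End ℂ (Elt M) →ₗ[ℂ] Elt M).restrictScalars ℝ)) (fun u _ => ?_) hT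
  rw [Set.mem_ofPred_eq, Set.mem_singleton_iff, ad_apply, mul_one,
    Unitary.mul_star_self_of_mem u.2]

lemma trace_average (hτ : IsNormalizedTrace M τ) {S : Subgroup (unitary (Elt M))}
    {T : Module.End ℂ (Elt M)} (hT : T ∈ averages S) (x : Elt M) : τ (T x) = τ x := by
  simpa using trace_mul_average hτ hT (a := 1) (by simp) x

lemma IsTypeIIOneFactor.exists_average_lt (hM : IsTypeIIOneFactor M) (hτ : IsNormalizedTrace M τ)
    (x : Elt M) {ε : ℝ} (hε : 0 < ε) :
    ∃ T ∈ averages (⊤ : Subgroup (unitary (Elt M))), ‖toL2 hτ (T x - τ x • 1)‖ < ε := by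
  obtain ⟨y, T, hT, hlim, hy⟩ := exists_fixed_limit_averages hτ ⊤ x
  obtain ⟨c, rfl⟩ := hM.factor y fun b =>
    mul_comm_of_unitary (AlgHom.id ℂ (Elt M)) (fun u => (hy u trivial).symm) b
  have hc : c = τ x := by
    have h1 : Tendsto (fun n => τ (T n x)) atTop (𝓝 (τ (c • (1 : Elt M)))) := by
      have := (tendsto_const_nhds (x := toL2 hτ 1)).inner (𝕜 := ℂ) hlim
      simpa only [inner_toL2, star_one, one_mul] using this
    simp_rw [trace_average hτ (hT _)] at h1
    have := tendsto_nhds_unique h1 tendsto_const_nhds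
    simpa [hτ.map_one] using this
  subst hc
  obtain ⟨n, hn⟩ := ((tendsto_iff_norm_sub_tendsto_zero.1 hlim).eventually_lt_const hε).exists
  exact ⟨T n, hT n, by rwa [map_sub]⟩

/-- Finitely many elements of a `II₁` factor are simultaneously averaged to their traces. -/
lemma IsTypeIIOneFactor.exists_average_lt_finset (hM : IsTypeIIOneFactor M)
    (hτ : IsNormalizedTrace M τ) {ι : Type*} (s : Finset ι) (x : ι → Elt M) {ε : ℝ} (hε : 0 < ε) :
    ∃ T ∈ averages (⊤ : Subgroup (unitary (Elt M))),
      ∀ i ∈ s, ‖toL2 hτ (T (x i) - τ (x i) • 1)‖ < ε := by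
  classical
  induction s using Finset.induction_on with
  | empty => exact ⟨ad 1, ad_mem_averages trivial, by simp⟩
  | insert j s _ ih =>
    obtain ⟨T, hT, hTs⟩ := ih
    -- A further average `T'` fixes 1 and contracts `‖·‖₂`, so the estimates already obtained for
    -- `T` survive.
    obtain ⟨T', hT', hTj⟩ := hM.exists_average_lt hτ (T (x j)) hε
    refine ⟨T' * T, mul_mem_averages hT' hT, fun i hi => ?_⟩
    rcases Finset.mem_insert.1 hi with rfl | hi
    · rwa [trace_average hτ hT] at hTj
    · have : (T' * T) (x i) - τ (x i) • 1 = T' (T (x i) - τ (x i) • 1) := by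
        rw [map_sub, map_smul, average_one hT', Module.End.mul_apply]
      rw [this]
      exact (norm_toL2_average_le hτ hT' _).trans_lt (hTs i hi)

/-! ### Projections in a masa -/

lemma norm_toL2_projection_sq (hτ : IsNormalizedTrace M τ) {q : Elt M} (hq : IsStarProjection q) :
    ‖toL2 hτ q‖ ^ 2 = (τ q).re := by
  rw [norm_toL2_sq, hq.isSelfAdjoint.star_eq, hq.isIdempotentElem.eq]

lemma trace_projection_pos (hτ : IsNormalizedTrace M τ) {q : Elt M} (hq : IsStarProjection q)
    (h0 : q ≠ 0) : 0 < (τ q).re := by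
  rw [← norm_toL2_projection_sq hτ hq]
  have : toL2 hτ q ≠ 0 := by simpa using h0
  positivity

lemma trace_projection_nonneg (hτ : IsNormalizedTrace M τ) {q : Elt M} (hq : IsStarProjection q) :
    0 ≤ (τ q).re := by
  rw [← norm_toL2_projection_sq hτ hq]
  positivity

lemma trace_projection_im (hτ : IsNormalizedTrace M τ) {q : Elt M} (hq : IsStarProjection q) :
    (τ q).im = 0 := by
  have := (Complex.nonneg_iff.1 (hτ.nonneg q)).2
  rw [hq.isSelfAdjoint.star_eq, hq.isIdempotentElem.eq] at this
  exact this.symm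

/-- The kernel projection of an operator. -/
lemma exists_kernel_projection (S : H →L[ℂ] H) :
    ∃ Q : H →L[ℂ] H, IsStarProjection Q ∧ S * Q = 0 ∧ (∀ X, S * X = 0 → Q * X = X) ∧
      ∀ a, a * S = S * a → star a * S = S * star a → a * Q = Q * a := by
  have : CompleteSpace S.ker := S.isClosed_ker.completeSpace_coe
  have hsp : IsStarProjection S.ker.starProjection := isStarProjection_starProjection
  have hfix : ∀ a : H →L[ℂ] H, a * S = S * a →
      S.ker.starProjection * (a * S.ker.starProjection) = a * S.ker.starProjection := by
    intro a ha
    ext v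
    refine Submodule.starProjection_eq_self_iff.2 ?_
    have h1 : S (S.ker.starProjection v) = 0 := Submodule.starProjection_apply_mem S.ker v
    change (S * a) _ = 0
    rw [← ha]
    change a (S (S.ker.starProjection v)) = 0
    rw [h1, map_zero]
  refine ⟨S.ker.starProjection, hsp, ?_, fun X hX => ?_, fun a ha ha' => ?_⟩
  · ext v
    exact Submodule.starProjection_apply_mem S.ker v
  · ext v
    refine Submodule.starProjection_eq_self_iff.2 ?_
    exact congrArg (fun Y : H →L[ℂ] H => Y v) hX
  · have h1 := hfix a ha
    have h2 := congrArg star (hfix _ ha')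
    simp only [star_mul, star_star, hsp.isSelfAdjoint.star_eq] at h2
    rw [← h1, ← mul_assoc, h2]

/-- The kernel projection of an element of a masa lies in the masa. -/
lemma IsMasa.exists_kernel_projection (hA : IsMasa A) {s : Elt M} (hs : s ∈ A) :
    ∃ Q ∈ A, IsStarProjection Q ∧ s * Q = 0 ∧ ∀ x, s * x = 0 → Q * x = x := by
  obtain ⟨Q, hQ, hsQ, hQx, hcomm⟩ := VNA.exists_kernel_projection (s : H →L[ℂ] H)
  have hmem : Q ∈ M.toStarSubalgebra := by
    rw [VonNeumannAlgebra.mem_carrier, ← M.centralizer_centralizer]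
    intro a ha
    rw [Set.mem_centralizer_iff] at ha
    refine hcomm a (ha _ s.2).symm ?_
    have := congrArg star (ha _ (star s).2)
    simpa using this
  refine ⟨⟨Q, hmem⟩, hA.mem_of_commute fun a ha => ?_, ⟨?_, ?_⟩, Subtype.ext hsQ,
    fun x hx => Subtype.ext (hQx _ (congrArg Subtype.val hx))⟩
  · exact Subtype.ext (hcomm _ (congrArg Subtype.val (hA.prop a ha s hs))
      (congrArg Subtype.val (hA.prop _ (star_mem ha) s hs)))
  · exact Subtype.ext hQ.isIdempotentElem
  · exact Subtype.ext hQ.isSelfAdjoint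

/-- If `s` vanishes on `p`, then `h = -t² p` is minus a positive element of trace zero, so
faithfulness applies. -/
lemma eq_zero_of_trace_eq_zero (hτ : IsNormalizedTrace M τ) {h s t p : Elt M}
    (ht : IsSelfAdjoint t) (hp : IsStarProjection p) (hst : h = s * s - t * t)
    (hhp : h * p = h) (hτh : τ h = 0) (hsp : s * p = 0) : h = 0 := by
  have h1 : h = -(t * t * p) := by
    rw [← hhp, hst, sub_mul, mul_assoc s, hsp, mul_zero, zero_sub]
  have h2 : t * p = 0 := by
    apply hτ.faithful
    rw [star_mul, ht.star_eq, hp.isSelfAdjoint.star_eq, hτ.tracial]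
    have : t * p * (p * t) = t * (p * p) * t := by simp only [mul_assoc]
    rw [this, hp.isIdempotentElem.eq, hτ.tracial, ← mul_assoc]
    rw [h1, map_neg, neg_eq_zero] at hτh
    exact hτh
  rw [h1, mul_assoc, h2, mul_zero, neg_zero]

/-- A masa of a `II₁` factor has no minimal projections. -/
lemma IsMasa.exists_subprojection (hM : IsTypeIIOneFactor M) (hτ : IsNormalizedTrace M τ)
    (hA : IsMasa A) {p : Elt M} (hpA : p ∈ A) (hp : IsStarProjection p) (h0 : p ≠ 0) :
    ∃ q ∈ A, IsStarProjection q ∧ p * q = q ∧ q ≠ 0 ∧ q ≠ p := by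
  -- If `A` acts on `p` by scalars, every subprojection of `p` in `M` commutes with `A` and so
  -- belongs to it. Otherwise some `a p` is not scalar and can be cut spectrally.
  by_cases hsc : ∀ a ∈ A, IsSelfAdjoint a → ∃ c : ℂ, a * p = c • p
  · obtain ⟨q, hq, hpq, hq0, hqp⟩ := hM.no_minimal_projection p hp h0
    refine ⟨q, hA.mem_of_commute fun a ha => ?_, hq, hpq, hq0, hqp⟩
    have hqp' : q * p = q := by
      have := congrArg star hpq
      rwa [star_mul, hq.isSelfAdjoint.star_eq, hp.isSelfAdjoint.star_eq] at this
    have key : ∀ a ∈ A, IsSelfAdjoint a → a * q = q * a := by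
      intro a ha hsa
      obtain ⟨c, hc⟩ := hsc a ha hsa
      have h1 : a * q = c • q := by rw [← hpq, ← mul_assoc, hc, smul_mul_assoc]
      have h2 : q * a = c • q := by
        rw [← hqp', mul_assoc, hA.prop p hpA a ha, hc, mul_smul_comm]
      rw [h1, h2]
    have hr : ∀ (r : ℝ), ∀ x ∈ A, r • x ∈ A := fun r x hx => by
      rw [← Complex.coe_smul]
      exact A.smul_mem hx _
    have hre : ((realPart a : selfAdjoint (Elt M)) : Elt M) ∈ A := by
      rw [realPart_apply_coe]
      exact hr _ _ (add_mem ha (star_mem ha))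
    have him : ((imaginaryPart a : selfAdjoint (Elt M)) : Elt M) ∈ A := by
      rw [imaginaryPart_apply_coe]
      exact A.smul_mem (hr _ _ (sub_mem ha (star_mem ha))) _
    rw [← realPart_add_I_smul_imaginaryPart a, add_mul, mul_add, smul_mul_assoc, mul_smul_comm,
      key _ hre (realPart a).2, key _ him (imaginaryPart a).2]
  · push Not at hsc
    obtain ⟨a, ha, hsa, hne⟩ := hsc
    have hap : a * p = p * a := hA.prop a ha p hpA
    -- This `c` makes `τ h = 0`, so that `h ≠ 0` has both a positive and a negative part.
    set c : ℝ := (τ (a * p)).re / (τ p).re with hc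
    set h : Elt M := a * p - (c : ℂ) • p with hh
    have hhA : h ∈ A := sub_mem (mul_mem ha hpA) (A.smul_mem hpA _)
    have hapsa : IsSelfAdjoint (a * p) := by
      rw [IsSelfAdjoint, star_mul, hsa.star_eq, hp.isSelfAdjoint.star_eq, hap]
    have hhsa : IsSelfAdjoint h :=
      hapsa.sub (by simp [IsSelfAdjoint, star_smul, hp.isSelfAdjoint.star_eq])
    have hh0 : h ≠ 0 := fun h0 => hne c (sub_eq_zero.1 h0)
    have hhp : h * p = h := by
      rw [hh, sub_mul, mul_assoc, smul_mul_assoc, hp.isIdempotentElem.eq]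
    have hτh : τ h = 0 := by
      have h1 : (τ (a * p)).im = 0 := by
        have := congrArg Complex.im (hτ.map_star (a * p))
        rw [hapsa.star_eq] at this
        simp at this
        linarith
      have h2 := trace_projection_im hτ hp
      have h3 := trace_projection_pos hτ hp h0
      rw [hh, map_sub, map_smul, smul_eq_mul]
      apply Complex.ext
      · simp [hc, h2, h3.ne']
      · simp [h1, h2]
    obtain ⟨s, t, hs, ht, hst, hsum, hcomm⟩ := exists_sq_sub_sq hhsa
    have hsA : s ∈ A := hA.mem_of_commute fun b hb => (hcomm b (hA.prop h hhA b hb)).1.symm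
    have htA : t ∈ A := hA.mem_of_commute fun b hb => (hcomm b (hA.prop h hhA b hb)).2.symm
    obtain ⟨Q, hQA, hQ, hsQ, hQx⟩ := hA.exists_kernel_projection hsA
    have hpQ := hA.prop p hpA Q hQA
    -- If `p Q = 0` then `t p = 0`, since `Q t = t`; if `p Q = p` then `s p = 0`. Either forces `h =
    -- 0`.
    refine ⟨p * Q, mul_mem hpA hQA, hp.mul hQ hpQ, ?_, fun h1 => hh0 ?_, fun h1 => hh0 ?_⟩
    · rw [← mul_assoc, hp.isIdempotentElem.eq]
    · have h2 : t * p = 0 := by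
        rw [hA.prop t htA p hpA, ← hQx t hst, ← mul_assoc, h1, zero_mul]
      refine neg_eq_zero.1 (eq_zero_of_trace_eq_zero hτ (h := -h) (s := t) (t := s) hs hp
        ?_ ?_ ?_ h2)
      · rw [hsum, neg_sub]
      · rw [neg_mul, hhp]
      · rw [map_neg, hτh, neg_zero]
    · refine eq_zero_of_trace_eq_zero hτ ht hp hsum hhp hτh ?_
      rw [← h1, hpQ, ← mul_assoc, hsQ, zero_mul]

lemma isStarProjection_sub {p q : Elt M} (hp : IsStarProjection p) (hq : IsStarProjection q)
    (h1 : p * q = q) (h2 : q * p = q) : IsStarProjection (p - q) := by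
  refine ⟨?_, hp.isSelfAdjoint.sub hq.isSelfAdjoint⟩
  rw [IsIdempotentElem, sub_mul, mul_sub, mul_sub, h1, h2, hp.isIdempotentElem.eq,
    hq.isIdempotentElem.eq, sub_self, sub_zero]

/-- Nonzero projections of a masa of a `II₁` factor have nonzero subprojections of small trace. -/
lemma IsMasa.exists_small_subprojection (hM : IsTypeIIOneFactor M) (hτ : IsNormalizedTrace M τ)
    (hA : IsMasa A) {p : Elt M} (hpA : p ∈ A) (hp : IsStarProjection p) (h0 : p ≠ 0) {ε : ℝ}
    (hε : 0 < ε) :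
    ∃ q ∈ A, IsStarProjection q ∧ p * q = q ∧ q ≠ 0 ∧ (τ q).re ≤ ε := by
  have key : ∀ n : ℕ, ∃ q ∈ A, IsStarProjection q ∧ p * q = q ∧ q ≠ 0 ∧
      (τ q).re ≤ (τ p).re * (1 / 2) ^ n := by
    intro n
    induction n with
    | zero => exact ⟨p, hpA, hp, hp.isIdempotentElem, h0, by simp⟩
    | succ n ih =>
      obtain ⟨q, hqA, hq, hpq, hq0, hqn⟩ := ih
      obtain ⟨r, hrA, hr, hqr, hr0, hrq⟩ := hA.exists_subprojection hM hτ hqA hq hq0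
      have hpr : p * r = r := by rw [← hqr, ← mul_assoc, hpq]
      -- One of `r` and `q - r` has at most half the trace of `q`.
      rcases le_total (τ r).re ((τ q).re / 2) with h | h
      · refine ⟨r, hrA, hr, hpr, hr0, h.trans ?_⟩
        rw [pow_succ]
        linarith
      · refine ⟨q - r, sub_mem hqA hrA,
          isStarProjection_sub hq hr hqr ((hA.prop q hqA r hrA).symm.trans hqr), ?_,
          sub_ne_zero.2 hrq.symm, ?_⟩
        · rw [mul_sub, hpq, hpr]
        · rw [map_sub, Complex.sub_re, pow_succ]
          linarith
  have hpos := trace_projection_pos hτ hp h0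
  obtain ⟨n, hn⟩ := exists_pow_lt_of_lt_one (div_pos hε hpos) (by norm_num : (1 / 2 : ℝ) < 1)
  obtain ⟨q, hqA, hq, hpq, hq0, hqn⟩ := key n
  refine ⟨q, hqA, hq, hpq, hq0, hqn.trans ?_⟩
  rw [lt_div_iff₀ hpos] at hn
  linarith

end Projections

/-! ### Partitions of unity of small trace, almost orthogonal unitaries and the bound -/

section Singularity

variable {M : VonNeumannAlgebra H} {τ : Elt M →ₗ[ℂ] ℂ} {A : StarSubalgebra ℂ (Elt M)}

/-- Only the left factors need an operator norm bound: right multiplication by the fixed `y₀` is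
`‖·‖₂`-bounded, by taking adjoints. -/
lemma tendsto_toL2_mul (hτ : IsNormalizedTrace M τ) {ι : Type*} {l : Filter ι} {x y : ι → Elt M}
    {x₀ y₀ : Elt M} {C : ℝ} (hC : ∀ n, ‖x n‖ ≤ C)
    (hx : Tendsto (fun n => toL2 hτ (x n)) l (𝓝 (toL2 hτ x₀)))
    (hy : Tendsto (fun n => toL2 hτ (y n)) l (𝓝 (toL2 hτ y₀))) :
    Tendsto (fun n => toL2 hτ (x n * y n)) l (𝓝 (toL2 hτ (x₀ * y₀))) := by
  rw [tendsto_iff_norm_sub_tendsto_zero] at hx hy ⊢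
  have hlim := (hy.const_mul C).add (hx.const_mul ‖star y₀‖)
  rw [mul_zero, mul_zero, add_zero] at hlim
  refine squeeze_zero (fun n => norm_nonneg _) (fun n => ?_) hlim
  have e : x n * y n - x₀ * y₀ = x n * (y n - y₀) + (x n - x₀) * y₀ := by
    rw [mul_sub, sub_mul]
    abel
  rw [← map_sub, ← map_sub, ← map_sub, e, map_add]
  refine (norm_add_le _ _).trans (add_le_add ?_ ?_)
  · exact (norm_toL2_mul_le hτ _ _).trans (by gcongr; exact hC n)
  · rw [← norm_toL2_star, star_mul, ← norm_toL2_star hτ (x n - x₀)]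
    exact norm_toL2_mul_le hτ _ _

lemma tendsto_toL2_star (hτ : IsNormalizedTrace M τ) {ι : Type*} {l : Filter ι} {x : ι → Elt M}
    {x₀ : Elt M} (hx : Tendsto (fun n => toL2 hτ (x n)) l (𝓝 (toL2 hτ x₀))) :
    Tendsto (fun n => toL2 hτ (star (x n))) l (𝓝 (toL2 hτ (star x₀))) := by
  rw [tendsto_iff_norm_sub_tendsto_zero] at hx ⊢
  simpa only [← map_sub, ← star_sub, norm_toL2_star] using hx

lemma tendsto_trace (hτ : IsNormalizedTrace M τ) {ι : Type*} {l : Filter ι} {x : ι → Elt M}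
    {x₀ : Elt M} (hx : Tendsto (fun n => toL2 hτ (x n)) l (𝓝 (toL2 hτ x₀))) :
    Tendsto (fun n => (τ (x n)).re) l (𝓝 (τ x₀).re) := by
  have := (tendsto_const_nhds (x := toL2 hτ 1)).inner (𝕜 := ℂ) hx
  simp only [inner_toL2, star_one, one_mul] at this
  exact (Complex.continuous_re.tendsto _).comp this

lemma norm_projection_le_one {q : Elt M} (hq : IsStarProjection q) : ‖q‖ ≤ 1 := by
  have h := CStarRing.norm_star_mul_self (x := q)
  rw [hq.isSelfAdjoint.star_eq, hq.isIdempotentElem.eq] at h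
  nlinarith [norm_nonneg q]

/-- `p` is a finite sum of orthogonal projections of `A` of trace at most `ε`. -/
def IsSmallSum (τ : Elt M →ₗ[ℂ] ℂ) (A : StarSubalgebra ℂ (Elt M)) (ε : ℝ) (p : Elt M) : Prop :=
  ∃ (ι : Type) (_ : Fintype ι) (f : ι → Elt M),
    (∀ i, f i ∈ A ∧ IsStarProjection (f i) ∧ (τ (f i)).re ≤ ε) ∧
      (Pairwise fun i j => f i * f j = 0) ∧ ∑ i, f i = p

lemma IsSmallSum.mem {ε : ℝ} {p : Elt M} (h : IsSmallSum τ A ε p) : p ∈ A := by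
  obtain ⟨ι, _, f, hf, -, rfl⟩ := h
  exact sum_mem fun i _ => (hf i).1

lemma IsSmallSum.isStarProjection {ε : ℝ} {p : Elt M} (h : IsSmallSum τ A ε p) :
    IsStarProjection p := by
  classical
  obtain ⟨ι, _, f, hf, hfo, rfl⟩ := h
  refine ⟨?_, ?_⟩
  · rw [IsIdempotentElem, Finset.sum_mul]
    refine Finset.sum_congr rfl fun i _ => ?_
    rw [Finset.mul_sum, Finset.sum_eq_single i (fun j _ hj => hfo hj.symm) (by simp),
      (hf i).2.1.isIdempotentElem.eq]
  · rw [IsSelfAdjoint, star_sum]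
    exact Finset.sum_congr rfl fun i _ => (hf i).2.1.isSelfAdjoint

lemma isSmallSum_of_trace_le {ε : ℝ} {p : Elt M} (hpA : p ∈ A) (hp : IsStarProjection p)
    (h : (τ p).re ≤ ε) : IsSmallSum τ A ε p :=
  ⟨Unit, inferInstance, fun _ => p, fun _ => ⟨hpA, hp, h⟩, fun i j hij => (hij rfl).elim, by simp⟩

/-- Small sums are stable under joins. -/
lemma IsSmallSum.join (hτ : IsNormalizedTrace M τ) (hA : IsMasa A) {ε : ℝ} {p q : Elt M}
    (hp : IsSmallSum τ A ε p) (hq : IsSmallSum τ A ε q) :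
    IsSmallSum τ A ε (p + (1 - p) * q) := by
  have hpA := hp.mem
  have hpp := hp.isStarProjection
  obtain ⟨ι, _, f, hf, hfo, hfp⟩ := hp
  obtain ⟨κ, _, g, hg, hgo, rfl⟩ := hq
  have hp1 : IsStarProjection (1 - p) := hpp.one_sub
  have hp1A : 1 - p ∈ A := sub_mem (one_mem A) hpA
  have hpf : ∀ i, (1 - p) * f i = 0 := by
    classical
    intro i
    rw [sub_mul, one_mul, ← hfp, Finset.sum_mul,
      Finset.sum_eq_single i (fun j _ hj => hfo hj) (by simp), (hf i).2.1.isIdempotentElem.eq,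
      sub_self]
  have hcomm : ∀ j, (1 - p) * g j = g j * (1 - p) := fun j => hA.prop _ hp1A _ (hg j).1
  refine ⟨ι ⊕ κ, inferInstance, Sum.elim f fun j => (1 - p) * g j, ?_, ?_, ?_⟩
  · rintro (i | j)
    · exact hf i
    · refine ⟨mul_mem hp1A (hg j).1, hp1.mul (hg j).2.1 (hcomm j), ?_⟩
      refine le_trans ?_ (hg j).2.2
      simp only [Sum.elim_inr]
      rw [← norm_toL2_projection_sq hτ (hp1.mul (hg j).2.1 (hcomm j)),
        ← norm_toL2_projection_sq hτ (hg j).2.1]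
      gcongr
      refine (norm_toL2_mul_le hτ _ _).trans ?_
      exact mul_le_of_le_one_left (norm_nonneg _) (norm_projection_le_one hp1)
  · rintro (i | j) (i' | j') hne
    · exact hfo fun h => hne (by rw [h])
    · simp only [Sum.elim_inl, Sum.elim_inr]
      rw [← mul_assoc, hA.prop _ (hf i).1 _ hp1A, hpf, zero_mul]
    · simp only [Sum.elim_inl, Sum.elim_inr]
      rw [hcomm, mul_assoc, hpf, mul_zero]
    · simp only [Sum.elim_inr]
      rw [hcomm, mul_assoc, ← mul_assoc _ _ (g j'), hp1.isIdempotentElem.eq, hcomm, ← mul_assoc,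
        hgo fun h => hne (by rw [h]), zero_mul]
  · rw [Fintype.sum_sum_type, ← hfp, Finset.mul_sum]
    rfl

/-- The unit is a finite sum of orthogonal projections of `A` of small trace. -/
lemma IsMasa.isSmallSum_one (hM : IsTypeIIOneFactor M) (hτ : IsNormalizedTrace M τ)
    (hA : IsMasa A) {ε : ℝ} (hε : 0 < ε) : IsSmallSum τ A ε 1 := by
  -- Exhaustion: small sums with traces tending to the supremum converge in `‖·‖₂` to a projection
  -- `z` of `A`.
  set S : Set ℝ := {r | ∃ p, IsSmallSum τ A ε p ∧ (τ p).re = r} with hS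
  have hτle : ∀ p : Elt M, IsStarProjection p → (τ p).re ≤ 1 := fun p hp => by
    rw [← norm_toL2_projection_sq hτ hp]
    exact pow_le_one₀ (norm_nonneg _) ((norm_toL2_le hτ p).trans (norm_projection_le_one hp))
  have hbdd : BddAbove S := ⟨1, by rintro _ ⟨p, hp, rfl⟩; exact hτle p hp.isStarProjection⟩
  have hne : S.Nonempty := ⟨_, 0, isSmallSum_of_trace_le (zero_mem A)
    (IsStarProjection.zero (R := Elt M)) (by simpa using hε.le), rfl⟩
  have hle : ∀ p, IsSmallSum τ A ε p → (τ p).re ≤ sSup S := fun p hp => le_csSup hbdd ⟨p, hp, rfl⟩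
  have hjoin : ∀ p q, IsSmallSum τ A ε p → IsSmallSum τ A ε q →
      (τ p).re + (τ q).re - (τ (p * q)).re ≤ sSup S := fun p q hp hq => by
    have := hle _ (hp.join hτ hA hq)
    rw [sub_mul, one_mul, map_add, map_sub, Complex.add_re, Complex.sub_re] at this
    linarith
  obtain ⟨r, -, hr, hrS⟩ := exists_seq_tendsto_sSup hne hbdd
  choose p hp hpr using hrS
  have hlim : Tendsto (fun n => (τ (p n)).re) atTop (𝓝 (sSup S)) := by simpa only [hpr] using hr
  have hproj := fun n => (hp n).isStarProjection
  have hnorm : ∀ n, ‖p n‖ ≤ 1 := fun n => norm_projection_le_one (hproj n)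
  have hdist : ∀ m n, ‖toL2 hτ (p m - p n)‖ ^ 2 ≤
      (sSup S - (τ (p m)).re) + (sSup S - (τ (p n)).re) := by
    intro m n
    -- The join of `pₘ` and `pₙ` has trace at most the supremum, which bounds `τ(pₘ pₙ)` from below.
    have h1 := hjoin _ _ (hp m) (hp n)
    have h2 : p n * p m = p m * p n := hA.prop _ (hp n).mem _ (hp m).mem
    rw [norm_toL2_sq, ((hproj m).isSelfAdjoint.sub (hproj n).isSelfAdjoint).star_eq, sub_mul,
      mul_sub, mul_sub, (hproj m).isIdempotentElem.eq, (hproj n).isIdempotentElem.eq, h2]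
    simp only [map_sub, Complex.sub_re]
    linarith
  have hcauchy : CauchySeq fun n => toL2 hτ (p n) := by
    rw [Metric.cauchySeq_iff]
    intro δ hδ
    have h1 : ∀ᶠ n in atTop, sSup S - δ ^ 2 / 2 < (τ (p n)).re :=
      hlim.eventually_const_lt (by linarith [pow_pos hδ 2])
    obtain ⟨N, hN⟩ := eventually_atTop.1 h1
    refine ⟨N, fun m hm n hn => ?_⟩
    rw [dist_eq_norm, ← map_sub]
    refine lt_of_pow_lt_pow_left₀ 2 hδ.le ((hdist m n).trans_lt ?_)
    linarith [hN m hm, hN n hn]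
  obtain ⟨z, -, hz, -⟩ := exists_tendsto_toL2 hτ hnorm hcauchy
  have hzA : z ∈ A := hA.mem_of_commute fun a ha => by
    refine (toL2 hτ).injective (tendsto_nhds_unique
      (tendsto_toL2_mul hτ (fun _ => le_rfl) tendsto_const_nhds hz) ?_)
    simp_rw [hA.prop a ha _ (hp _).mem]
    exact tendsto_toL2_mul hτ hnorm hz tendsto_const_nhds
  have hzp : IsStarProjection z := by
    refine ⟨(toL2 hτ).injective (tendsto_nhds_unique (tendsto_toL2_mul hτ hnorm hz hz) ?_),
      (toL2 hτ).injective (tendsto_nhds_unique (tendsto_toL2_star hτ hz) ?_)⟩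
    · simpa only [(hproj _).isIdempotentElem.eq] using hz
    · simpa only [(hproj _).isSelfAdjoint.star_eq] using hz
  -- Otherwise joining `pₙ` with a small projection `q` under `1 - z` would eventually exceed the
  -- supremum, because `τ(pₙ q)` tends to `τ(z q) = 0`.
  have hz1 : z = 1 := by
    by_contra hne1
    obtain ⟨q, hqA, hq, hzq, hq0, hqε⟩ := hA.exists_small_subprojection hM hτ
      (sub_mem (one_mem A) hzA) hzp.one_sub (sub_ne_zero.2 (Ne.symm hne1)) hε
    have hzq0 : z * q = 0 := by
      rw [sub_mul, one_mul] at hzq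
      exact sub_eq_self.1 hzq
    have h1 := (hlim.add_const (τ q).re).sub
      (tendsto_trace hτ (tendsto_toL2_mul hτ hnorm hz (tendsto_const_nhds (x := toL2 hτ q))))
    have h2 := le_of_tendsto' h1 fun n => hjoin _ _ (hp n) (isSmallSum_of_trace_le hqA hq hqε)
    rw [hzq0, map_zero, Complex.zero_re] at h2
    linarith [trace_projection_pos hτ hq hq0]
  have hτ1 := tendsto_trace hτ hz
  rw [hz1, hτ.map_one, Complex.one_re] at hτ1
  -- Finiteness of the sum: for one `n` the remainder `1 - pₙ` is itself small enough to be the last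
  -- term.
  obtain ⟨n, hn⟩ := (hτ1.eventually_const_lt (by linarith : 1 - ε < 1)).exists
  have hsmall : IsSmallSum τ A ε (1 - p n) :=
    isSmallSum_of_trace_le (sub_mem (one_mem A) (hp n).mem) (hproj n).one_sub (by
      rw [map_sub, hτ.map_one, Complex.sub_re, Complex.one_re]
      linarith)
  have := (hp n).join hτ hA hsmall
  rwa [(hproj n).one_sub.isIdempotentElem.eq, add_sub_cancel] at this

/-- There are unitaries almost orthogonal to a masa of a `II₁` factor. -/
lemma IsMasa.exists_unitary_norm_condExp_le (hM : IsTypeIIOneFactor M)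
    (hτ : IsNormalizedTrace M τ) (hA : IsMasa A) {E : Elt M →ₗ[ℂ] Elt M} (hE : IsCondExp τ A E)
    {δ : ℝ} (hδ : 0 < δ) : ∃ u : unitary (Elt M), ‖toL2 hτ (E u)‖ ^ 2 ≤ δ := by
  classical
  obtain ⟨ι, _, f, hf, hfo, hf1⟩ := hA.isSmallSum_one hM hτ (half_pos hδ)
  -- The `+ 1` keeps `N` positive for an empty family. Half of `δ` pays for `∑ τ(fᵢ)² ≤ δ / 2`, half
  -- for the averaging errors.
  set N : ℝ := Fintype.card ι + 1 with hN
  have hNpos : 0 < N := by positivity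
  obtain ⟨T, hT, hTf⟩ := hM.exists_average_lt_finset hτ Finset.univ f
    (show 0 < δ / 2 / N by positivity)
  let φ : Module.End ℂ (Elt M) →ₗ[ℂ] ℂ := ∑ i,
    τ ∘ₗ LinearMap.mulLeft ℂ (f i) ∘ₗ LinearMap.applyₗ (R := ℂ) (f i)
  have hφ : ∀ T, φ T = ∑ i, τ (f i * T (f i)) := fun T => by simp [φ]
  have hφT : (φ T).re ≤ δ := by
    have hterm : ∀ i, (τ (f i * T (f i))).re ≤ δ / 2 * (τ (f i)).re + δ / 2 / N := by
      intro i
      have e : f i * T (f i) = f i * (T (f i) - τ (f i) • 1) + τ (f i) • f i := by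
        rw [mul_sub, mul_smul_comm, mul_one, sub_add_cancel]
      have h1 := norm_trace_mul_le hτ (f i) (T (f i) - τ (f i) • 1)
      have h2 : ‖toL2 hτ (star (f i))‖ ≤ 1 := by
        rw [norm_toL2_star]
        exact (norm_toL2_le hτ _).trans (norm_projection_le_one (hf i).2.1)
      have h3 := (hTf i (Finset.mem_univ i)).le
      have h4 : (τ (f i * (T (f i) - τ (f i) • 1))).re ≤ δ / 2 / N :=
        (Complex.re_le_norm _).trans (h1.trans
          ((mul_le_of_le_one_left (norm_nonneg _) h2).trans h3))
      rw [e, map_add, map_smul, Complex.add_re, smul_eq_mul, Complex.mul_re,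
        trace_projection_im hτ (hf i).2.1, mul_zero, sub_zero]
      have h5 := trace_projection_nonneg hτ (hf i).2.1
      nlinarith [(hf i).2.2]
    rw [hφ, Complex.re_sum]
    refine (Finset.sum_le_sum fun i _ => hterm i).trans ?_
    rw [Finset.sum_add_distrib, ← Finset.mul_sum, ← Complex.re_sum, ← map_sum, hf1, hτ.map_one,
      Complex.one_re, Finset.sum_const, nsmul_eq_mul, Finset.card_univ]
    have : (Fintype.card ι : ℝ) * (δ / 2 / N) ≤ δ / 2 := by
      rw [mul_div_assoc', div_le_iff₀ hNpos]
      nlinarith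
    linarith
  -- If `Re φ` exceeded `δ` at every conjugation, it would do so on their convex hull, which
  -- contains `T`.
  obtain ⟨u, hu⟩ : ∃ u : unitary (Elt M), (φ (ad u)).re ≤ δ := by
    by_contra! hcon
    have hconv : Convex ℝ {T : Module.End ℂ (Elt M) | δ < (φ T).re} :=
      (convex_Ioi δ).linear_preimage (Complex.reLm ∘ₗ φ.restrictScalars ℝ)
    exact (averages_induction hconv (fun u _ => hcon u) hT).not_ge hφT
  refine ⟨u, le_trans ?_ hu⟩
  set w : Elt M := ∑ i, f i * u * f i with hw
  -- `E(fᵢ u fᵢ) = fᵢ E(u) fᵢ = fᵢ E(u)`, as `A` is abelian, and the `fᵢ` sum to 1.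
  have hEw : E w = E u := by
    rw [hw, map_sum]
    have : ∀ i, E (f i * u * f i) = f i * E u := fun i => by
      rw [hE.bimodule _ (hf i).1 _ (hf i).1, mul_assoc, hA.prop _ (hE.mem _) _ (hf i).1,
        ← mul_assoc, (hf i).2.1.isIdempotentElem.eq]
    simp_rw [this]
    rw [← Finset.sum_mul, hf1, one_mul]
  have h1 := hE.norm_sub_apply_sq hτ w
  have h2 : ‖toL2 hτ w‖ ^ 2 = (φ (ad u)).re := by
    rw [norm_toL2_sq, hφ]
    congr 1
    rw [hw, star_sum, Finset.sum_mul, map_sum]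
    refine Finset.sum_congr rfl fun i _ => ?_
    have hsf := (hf i).2.1.isSelfAdjoint.star_eq
    rw [Finset.mul_sum, Finset.sum_eq_single i _ (by simp)]
    · rw [ad_apply, star_mul, star_mul, hsf]
      have e1 : f i * (star (u : Elt M) * f i) * (f i * u * f i) =
          f i * (star (u : Elt M) * (f i * f i) * u * f i) := by simp only [mul_assoc]
      have e2 : f i * (↑u * f i * star (u : Elt M)) = f i * u * f i * star (u : Elt M) := by
        simp only [mul_assoc]
      have e3 : star (u : Elt M) * f i * u * f i * f i = star (u : Elt M) * (f i * u * f i) := by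
        rw [mul_assoc _ (f i) (f i), (hf i).2.1.isIdempotentElem.eq]
        simp only [mul_assoc]
      rw [e1, (hf i).2.1.isIdempotentElem.eq, hτ.tracial, e3, e2, hτ.tracial]
    · intro j _ hj
      rw [star_mul, star_mul, hsf]
      have : f i * (star (u : Elt M) * f i) * (f j * u * f j) =
          f i * star (u : Elt M) * (f i * f j) * u * f j := by simp only [mul_assoc]
      rw [this, hfo hj.symm, mul_zero, zero_mul, zero_mul]
  rw [← h2, ← hEw]
  linarith [sq_nonneg ‖toL2 hτ (w - E w)‖]

lemma norm_toL2_unitary (hτ : IsNormalizedTrace M τ) (u : unitary (Elt M)) :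
    ‖toL2 hτ (u : Elt M)‖ = 1 := by
  simpa [norm_toL2_one] using norm_toL2_unitary_mul hτ u 1

/-- The invariant `α` of a masa of a `II₁` factor is at most one. -/
theorem IsMasa.alphaInv_le_one (hM : IsTypeIIOneFactor M) (hτ : IsNormalizedTrace M τ)
    (hA : IsMasa A) : alphaInv τ A ≤ 1 := by
  obtain ⟨E, hE⟩ := hA.exists_isCondExp hτ
  refine iSup₂_le fun α hα => ?_
  rw [← EReal.coe_one, EReal.coe_le_coe_iff]
  by_contra! hα1
  -- With this `δ`, `‖u - E u‖₂² ≥ 1 - δ > α⁻²`, contradicting `α ‖u - E u‖₂ ≤ 1`.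
  have hδ : 0 < (1 - (α ^ 2)⁻¹) / 2 := by
    have : (α ^ 2)⁻¹ < 1 := inv_lt_one_of_one_lt₀ (by nlinarith)
    linarith
  obtain ⟨u, hu⟩ := hA.exists_unitary_norm_condExp_le hM hτ hE hδ
  have h1 := (hα u E _ hE (hE.conj hτ u)).trans
    (normInftyTwo_condExp_sub_le_one hτ hE (hE.conj hτ u))
  rw [← EReal.coe_one, EReal.coe_le_coe_iff, ← norm_toL2 hτ] at h1
  have h2 := hE.norm_sub_apply_sq hτ u
  rw [norm_toL2_unitary, one_pow] at h2
  have h3 : (α * ‖toL2 hτ ((u : Elt M) - E u)‖) ^ 2 ≤ 1 :=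
    pow_le_one₀ (by positivity) h1
  rw [mul_pow, h2] at h3
  have h4 : α ^ 2 * (α ^ 2)⁻¹ = 1 := mul_inv_cancel₀ (by positivity)
  nlinarith

end Singularity

end VNA

end

theorem proposition2p3 {H : Type*} [NormedAddCommGroup H] [InnerProductSpace ℂ H]
    [CompleteSpace H] (M : VonNeumannAlgebra H) (hM : VNA.IsTypeIIOneFactor M)
    (τ : VNA.Elt M →ₗ[ℂ] ℂ) (hτ : VNA.IsNormalizedTrace M τ)
    (A : StarSubalgebra ℂ (VNA.Elt M)) (hA : VNA.IsMasa A) :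
    VNA.alphaInv τ A ≤ 1 :=
  hA.alphaInv_le_one hM hτ
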